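/- Let $d\ge 2$ be an integer. Let $H^2_d$ be the Drury–Arveson space, i.e. the reproducing kernel Hilbert space on the open unit ball $\mathbb B_d\subset\mathbb C^d$ with kernel $k_d(z,w)=\frac{1}{1-\langle z,w\rangle}$, and let $\mathcal M_d\subset B(H^2_d)$ be its multiplier algebra, the algebra of all operators $f\mapsto\varphi f$ where $\varphi\colon\mathbb B_d\to\mathbb C$ satisfies $\varphi H^2_d\subset H^2_d$. Let $M_6(\mathcal M_d)$ be the algebra of $6\times 6$ matrices over $\mathcal M_d$, acting on the Hilbert space $H^2_d\otimes\mathbb C^6=(H^2_d)^{\oplus 6}$. A weak-$*$ closed subalgebra $\mathfrak A\subset B(\mathcal H)$ is said to have property $\mathbb A_1(1)$ if for every weak-$*$ continuous linear functional $\psi$ on $\mathfrak A$ with $\|\psi\|<1$ there exist $\xi,\eta\in\mathcal H$ with $\|\xi\|<1$, $\|\eta\|<1$ such that $\psi(T)=\langle T\xi,\eta\rangle$ for every $T\in\mathfrak A$. Then $M_6(\mathcal M_d)\subset B(H^2_d\otimes\mathbb C^6)$ does not have property $\mathbb A_1(1)$. -/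

import Mathlib

noncomputable section

/-- The open unit ball of `ℂ^d` with the Euclidean norm. -/
abbrev UnitBall (d : ℕ) : Type := Metric.ball (0 : EuclideanSpace ℂ (Fin d)) 1

/-- The kernel `k_d(z, w) = 1 / (1 - ⟨z, w⟩)` on the unit ball, where `⟨z, w⟩ = ∑ z_i * conj w_i` is
Mathlib's `inner ℂ w z`. A scalar `c` is viewed as the operator `c • id` on `ℂ`. -/
def druryArvesonKernel (d : ℕ) : Matrix (UnitBall d) (UnitBall d) (ℂ →L[ℂ] ℂ) :=
  Matrix.of fun z w =>
    (1 / (1 - inner ℂ (w : EuclideanSpace ℂ (Fin d)) (z : EuclideanSpace ℂ (Fin d)))) •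
      ContinuousLinearMap.id ℂ ℂ

theorem hasSum_druryArvesonKernel {d : ℕ} (z w : UnitBall d) :
    HasSum (fun n : ℕ =>
        (inner ℂ (w : EuclideanSpace ℂ (Fin d)) (z : EuclideanSpace ℂ (Fin d))) ^ n)
      (1 / (1 - inner ℂ (w : EuclideanSpace ℂ (Fin d)) (z : EuclideanSpace ℂ (Fin d)))) := by
  rw [one_div]
  apply hasSum_geometric_of_norm_lt_one
  have hz : ‖(z : EuclideanSpace ℂ (Fin d))‖ < 1 := mem_ball_zero_iff.mp z.2
  have hw : ‖(w : EuclideanSpace ℂ (Fin d))‖ < 1 := mem_ball_zero_iff.mp w.2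
  calc _ ≤ ‖(w : EuclideanSpace ℂ (Fin d))‖ * ‖(z : EuclideanSpace ℂ (Fin d))‖ :=
        norm_inner_le_norm _ _
    _ < 1 := mul_lt_one_of_nonneg_of_lt_one_left (norm_nonneg _) hw hz.le

theorem re_sum_inner_pow_nonneg {d : ℕ} (n : ℕ) (s : Finset (UnitBall d)) (v : UnitBall d → ℂ) :
    0 ≤ (∑ x ∈ s, ∑ y ∈ s, (inner ℂ (y : EuclideanSpace ℂ (Fin d))
      (x : EuclideanSpace ℂ (Fin d))) ^ n * (v x * starRingEnd ℂ (v y))).re := by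
  have key : (∑ x ∈ s, ∑ y ∈ s, (inner ℂ (y : EuclideanSpace ℂ (Fin d))
      (x : EuclideanSpace ℂ (Fin d))) ^ n * (v x * starRingEnd ℂ (v y))) =
      ∑ p : Fin n → Fin d,
        (∑ x ∈ s, v x * ∏ i, (x : EuclideanSpace ℂ (Fin d)) (p i)) *
        starRingEnd ℂ (∑ x ∈ s, v x * ∏ i, (x : EuclideanSpace ℂ (Fin d)) (p i)) := by
    simp only [map_sum, Finset.sum_mul_sum]
    rw [Finset.sum_comm]
    simp only [Finset.sum_comm (s := Finset.univ (α := Fin n → Fin d))]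
    rw [Finset.sum_comm]
    refine Finset.sum_congr rfl fun x _ => Finset.sum_congr rfl fun y _ => ?_
    rw [PiLp.inner_apply, Fintype.sum_pow, Finset.sum_mul]
    refine Finset.sum_congr rfl fun p _ => ?_
    simp only [RCLike.inner_apply, Finset.prod_mul_distrib, map_mul, map_prod]
    ring
  rw [key, Complex.re_sum]
  refine Finset.sum_nonneg fun p _ => ?_
  rw [Complex.mul_conj]
  simpa using Complex.normSq_nonneg _

theorem posSemidef_druryArvesonKernel (d : ℕ) : (druryArvesonKernel d).PosSemidef := by
  have htfae := (RKHS.posSemidef_tfae (K := druryArvesonKernel d)).out 0 2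
  refine htfae.mpr ⟨?_, fun vv => ?_⟩
  · refine Matrix.ext fun z w => ContinuousLinearMap.ext fun v => ext_inner_right ℂ fun u => ?_
    rw [Matrix.conjTranspose_apply, ContinuousLinearMap.star_eq_adjoint,
      ContinuousLinearMap.adjoint_inner_left]
    simp [druryArvesonKernel, mul_left_comm, mul_assoc]
  · have h : HasSum (fun n : ℕ => ∑ x ∈ vv.support, ∑ y ∈ vv.support,
        (inner ℂ (y : EuclideanSpace ℂ (Fin d)) (x : EuclideanSpace ℂ (Fin d))) ^ n *
          (vv y * starRingEnd ℂ (vv x)))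
        (vv.sum fun x w => vv.sum fun y w' => inner ℂ (druryArvesonKernel d y x w) w') := by
      refine hasSum_sum fun x _ => hasSum_sum fun y _ => ?_
      have := (hasSum_druryArvesonKernel x y).mul_right (vv y * starRingEnd ℂ (vv x))
      have hv : inner ℂ (druryArvesonKernel d y x (vv x)) (vv y) = 1 / (1 -
          inner ℂ (y : EuclideanSpace ℂ (Fin d)) (x : EuclideanSpace ℂ (Fin d))) *
            (vv y * starRingEnd ℂ (vv x)) := by
        simp [druryArvesonKernel, mul_left_comm]
      rw [← hv] at this
      exact this
    refine (Complex.hasSum_re h).nonneg fun n => ?_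
    refine (re_sum_inner_pow_nonneg n vv.support fun x => starRingEnd ℂ (vv x)).trans_eq ?_
    refine congrArg Complex.re (Finset.sum_congr rfl fun x _ => Finset.sum_congr rfl fun y _ => ?_)
    rw [Complex.conj_conj, mul_comm (vv y)]

instance (d : ℕ) : Fact (druryArvesonKernel d).PosSemidef := ⟨posSemidef_druryArvesonKernel d⟩

/-- The Drury–Arveson space `H^2_d`: the Hilbert space of functions on the unit ball of `ℂ^d` with
reproducing kernel `druryArvesonKernel d`. -/
def DruryArveson (d : ℕ) : Type := RKHS.OfKernel (druryArvesonKernel d)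

instance (d : ℕ) : NormedAddCommGroup (DruryArveson d) :=
  inferInstanceAs (NormedAddCommGroup (RKHS.OfKernel (druryArvesonKernel d)))

instance (d : ℕ) : InnerProductSpace ℂ (DruryArveson d) :=
  inferInstanceAs (InnerProductSpace ℂ (RKHS.OfKernel (druryArvesonKernel d)))

instance (d : ℕ) : CompleteSpace (DruryArveson d) :=
  inferInstanceAs (CompleteSpace (RKHS.OfKernel (druryArvesonKernel d)))

instance (d : ℕ) : RKHS ℂ (DruryArveson d) (UnitBall d) ℂ :=
  inferInstanceAs (RKHS ℂ (RKHS.OfKernel (druryArvesonKernel d)) (UnitBall d) ℂ)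

theorem kernel_druryArveson (d : ℕ) : RKHS.kernel (DruryArveson d) = druryArvesonKernel d :=
  RKHS.OfKernel.kernel_ofKernel

/-- `φ` is a multiplier of the space of functions `H` if `φ * f ∈ H` for every `f ∈ H`. -/
def IsMultiplier (H : Type*) {X : Type*} [NormedAddCommGroup H] [InnerProductSpace ℂ H]
    [RKHS ℂ H X ℂ] (φ : X → ℂ) : Prop :=
  ∀ f : H, ∃ g : H, ∀ x, g x = φ x * f x

/-- The multiplier algebra of `H`, as the algebra of the multiplication operators `f ↦ φ * f` on
`H`, where `φ` runs through all multipliers. -/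
def multiplierAlgebra (H : Type*) {X : Type*} [NormedAddCommGroup H] [InnerProductSpace ℂ H]
    [RKHS ℂ H X ℂ] : Subalgebra ℂ (H →L[ℂ] H) where
  carrier := {T | ∃ φ : X → ℂ, IsMultiplier H φ ∧ ∀ (f : H) (x : X), T f x = φ x * f x}
  mul_mem' := by
    rintro S T ⟨φ, -, hS⟩ ⟨ψ, -, hT⟩
    have h : ∀ (f : H) (x : X), (S * T) f x = (φ x * ψ x) * f x := fun f x => by
      rw [mul_apply_eq_comp, hS, hT, mul_assoc]
    exact ⟨fun x => φ x * ψ x, fun f => ⟨_, h f⟩, h⟩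
  add_mem' := by
    rintro S T ⟨φ, -, hS⟩ ⟨ψ, -, hT⟩
    have h : ∀ (f : H) (x : X), (S + T) f x = (φ x + ψ x) * f x := fun f x => by
      simp [hS, hT, add_mul]
    exact ⟨fun x => φ x + ψ x, fun f => ⟨_, h f⟩, h⟩
  algebraMap_mem' c := by
    have h : ∀ (f : H) (x : X), (algebraMap ℂ (H →L[ℂ] H) c) f x = c * f x := fun f x => by
      simp [Algebra.algebraMap_eq_smul_one]
    exact ⟨fun _ => c, fun f => ⟨_, h f⟩, h⟩

/-- Every multiplier defines a (bounded) multiplication operator: closed graph theorem. -/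
theorem IsMultiplier.exists_mem_multiplierAlgebra {H X : Type*} [NormedAddCommGroup H]
    [InnerProductSpace ℂ H] [CompleteSpace H] [RKHS ℂ H X ℂ] {φ : X → ℂ} (hφ : IsMultiplier H φ) :
    ∃ T ∈ multiplierAlgebra H, ∀ (f : H) (x : X), T f x = φ x * f x := by
  choose g hg using hφ
  let L : H →ₗ[ℂ] H :=
    { toFun := g
      map_add' := fun f f' => by ext x; simp [hg, mul_add]
      map_smul' := fun c f => by ext x; simp [hg, mul_left_comm] }
  have hL : ∀ (f : H) (x : X), L f x = φ x * f x := hg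
  refine ⟨ContinuousLinearMap.ofSeqClosedGraph (g := L) fun u f f' hu hLu => ?_,
    ⟨φ, fun f => ⟨_, hL f⟩, hL⟩, hL⟩
  ext x
  refine tendsto_nhds_unique (((RKHS.continuous_eval x).tendsto f').comp hLu) ?_
  have := (((RKHS.continuous_eval (𝕜 := ℂ) x).tendsto f).comp hu).const_mul (φ x)
  rw [hL]
  refine this.congr fun n => (hL (u n) x).symm

/-- The operator on `H^{⊕k} = H ⊗ ℂ^k` (the `ℓ²` direct sum) given by a `k × k` matrix of operators
on `H`. -/
def opOfMatrix {H : Type*} [NormedAddCommGroup H] [InnerProductSpace ℂ H] {k : ℕ}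
    (a : Matrix (Fin k) (Fin k) (H →L[ℂ] H)) :
    PiLp 2 (fun _ : Fin k => H) →L[ℂ] PiLp 2 (fun _ : Fin k => H) :=
  (PiLp.continuousLinearEquiv 2 ℂ (fun _ : Fin k => H)).symm.toContinuousLinearMap ∘L
    ContinuousLinearMap.pi fun i => ∑ j, a i j ∘L PiLp.proj 2 (fun _ : Fin k => H) j

@[simp]
theorem opOfMatrix_apply {H : Type*} [NormedAddCommGroup H] [InnerProductSpace ℂ H] {k : ℕ}
    (a : Matrix (Fin k) (Fin k) (H →L[ℂ] H)) (ξ : PiLp 2 (fun _ : Fin k => H)) (i : Fin k) :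
    opOfMatrix a ξ i = ∑ j, a i j (ξ j) := by
  simp [opOfMatrix]

/-- The algebra `M_k(A)` of `k × k` matrices over `A ⊆ B(H)`, acting on `H^{⊕k} = H ⊗ ℂ^k`. -/
def matrixAlgebra {H : Type*} [NormedAddCommGroup H] [InnerProductSpace ℂ H] (k : ℕ)
    (A : Subalgebra ℂ (H →L[ℂ] H)) :
    Subalgebra ℂ (PiLp 2 (fun _ : Fin k => H) →L[ℂ] PiLp 2 (fun _ : Fin k => H)) where
  carrier := {T | ∃ a : Matrix (Fin k) (Fin k) (H →L[ℂ] H), (∀ i j, a i j ∈ A) ∧ T = opOfMatrix a}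
  mul_mem' := by
    rintro _ _ ⟨a, ha, rfl⟩ ⟨b, hb, rfl⟩
    refine ⟨a * b, fun i j => ?_, ?_⟩
    · rw [Matrix.mul_apply]
      exact A.sum_mem fun l _ => A.mul_mem (ha i l) (hb l j)
    · ext ξ i
      simp only [mul_apply_eq_comp, opOfMatrix_apply, Matrix.mul_apply, map_sum,
        sum_apply]
      exact Finset.sum_comm
  add_mem' := by
    rintro _ _ ⟨a, ha, rfl⟩ ⟨b, hb, rfl⟩
    refine ⟨a + b, fun i j => A.add_mem (ha i j) (hb i j), ?_⟩
    ext ξ i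
    simp [Finset.sum_add_distrib]
  algebraMap_mem' c := by
    refine ⟨algebraMap ℂ _ c, fun i j => ?_, ?_⟩
    · rw [Matrix.algebraMap_matrix_apply]
      split_ifs
      · exact A.algebraMap_mem c
      · exact A.zero_mem
    · ext ξ i
      rw [opOfMatrix_apply, Finset.sum_eq_single i]
      · simp [Matrix.algebraMap_matrix_apply, Algebra.algebraMap_eq_smul_one]
      · intro j _ hj
        simp [Matrix.algebraMap_matrix_apply, hj.symm]
      · simp

/-- The weak-* (that is, ultraweak) topology of `B(H)`, the dual of the trace class operators. It is
the coarsest topology for which all functionals `T ↦ ∑ n, ⟨T x_n, y_n⟩` with `∑ ‖x_n‖² < ∞` and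
`∑ ‖y_n‖² < ∞` are continuous; these are the functionals `T ↦ tr (T S)`, `S` of trace class. -/
@[reducible]
def weakStarTopology (H : Type*) [NormedAddCommGroup H] [InnerProductSpace ℂ H] :
    TopologicalSpace (H →L[ℂ] H) :=
  ⨅ (x : ℕ → H) (y : ℕ → H) (_ : Summable fun n => ‖x n‖ ^ 2) (_ : Summable fun n => ‖y n‖ ^ 2),
    TopologicalSpace.induced (fun T : H →L[ℂ] H => ∑' n, inner ℂ (y n) (T (x n))) inferInstance

/-- The functional `φ` on `A ⊆ B(H)` is continuous for the weak-* topology of `B(H)` restricted to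
`A`. -/
def IsWeakStarContinuous {H : Type*} [NormedAddCommGroup H] [InnerProductSpace ℂ H]
    {A : Subalgebra ℂ (H →L[ℂ] H)} (φ : StrongDual ℂ A) : Prop :=
  @Continuous A ℂ ((weakStarTopology H).induced Subtype.val) inferInstance φ

/-- Property `𝔸₁(1)` of an operator algebra `A` acting on `H`. The norm `‖φ‖` is the norm of a
functional on `A` with the operator norm, and `inner ℂ η (T ξ)` is `⟨T ξ, η⟩`, which is linear in
the first variable. -/
def HasA11 {H : Type*} [NormedAddCommGroup H] [InnerProductSpace ℂ H]
    (A : Subalgebra ℂ (H →L[ℂ] H)) : Prop :=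
  ∀ φ : StrongDual ℂ A, IsWeakStarContinuous φ → ‖φ‖ < 1 →
    ∃ ξ η : H, ‖ξ‖ < 1 ∧ ‖η‖ < 1 ∧ ∀ T : A, φ T = inner ℂ η ((T : H →L[ℂ] H) ξ)

end

/-! Let e be the constant function 1 and let Z, W be multiplication by two different coordinates.
All of e, Ze, We have norm 1, but Z and W are jointly far from isometric away from e: ‖Zf‖² + ‖Wf‖²
≤ (3/2)‖f‖² + (1/2)|⟨f, e⟩|² (`norm_sq_coordMul_add_le`).

The bound comes from the full Fock space. There H²_d sits as symmetric vectors, and a coordinate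
multiplier is the compression of the left creation operator and also of the right one, hence of
their mean, whose norm on symmetric vectors is computed exactly (`norm_sq_adjoint_add_adjoint`).

In `not_hasA11_matrixAlgebra`, a rank-two functional prescribes ⟨Zξ₀, η₀⟩ = ⟨Wξ₀, η₂⟩ = ⟨Zξ₁, η₁⟩ =
⟨Wξ₁, η₃⟩ = c and ⟨Zξ₁, η₀⟩ = ⟨Zξ₀, η₁⟩ = 0. With c close to 1/(2√2), the first four equations push
ξ₀ and ξ₁ towards the line through e, so they are nearly parallel; the last two then cannot hold. -/

noncomputable section

/-! ### Isometries from Gram matrices; composition operators on ℓ² -/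

/-- Isometries defined on a family of vectors with dense span, from equality of Gram matrices. -/
theorem exists_linearIsometry_of_inner_eq {E F X : Type*} [NormedAddCommGroup E]
    [InnerProductSpace ℂ E] [NormedAddCommGroup F] [InnerProductSpace ℂ F] [CompleteSpace F]
    (k : X → E) (Φ : X → F) (hk : Dense (Submodule.span ℂ (Set.range k) : Set E))
    (h : ∀ x y, inner ℂ (k x) (k y) = inner ℂ (Φ x) (Φ y)) :
    ∃ U : E →ₗᵢ[ℂ] F, ∀ x, U (k x) = Φ x := by
  let e : (X →₀ ℂ) →ₗ[ℂ] E := Finsupp.linearCombination ℂ k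
  let f : (X →₀ ℂ) →ₗ[ℂ] F := Finsupp.linearCombination ℂ Φ
  have he : DenseRange e := by
    rw [DenseRange, ← LinearMap.coe_range, Finsupp.range_linearCombination]
    exact hk
  have hinner : ∀ v w, inner ℂ (f v) (f w) = inner ℂ (e v) (e w) := fun v w => by
    simp only [e, f, Finsupp.linearCombination_apply, Finsupp.sum, inner_sum, sum_inner,
      inner_smul_left, inner_smul_right, h]
  have hnorm : ∀ v, ‖f v‖ = ‖e v‖ := fun v => by
    rw [@norm_eq_sqrt_re_inner ℂ, hinner, ← @norm_eq_sqrt_re_inner ℂ]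
  have hb : ∀ v, ‖f v‖ ≤ 1 * ‖e v‖ := fun v => by rw [hnorm, one_mul]
  have hext := LinearMap.extendOfNorm_eq (f := f) (e := e) he ⟨1, hb⟩
  refine ⟨⟨(f.extendOfNorm e).toLinearMap, fun v => ?_⟩, fun x => ?_⟩
  · refine congrFun (DenseRange.equalizer (g := fun v => ‖f.extendOfNorm e v‖) (h := fun v => ‖v‖)
      he (by fun_prop) continuous_norm (funext fun v => ?_)) v
    simp [hext, hnorm]
  · have := hext (Finsupp.single x 1)
    simpa [e, f] using this

/-- Composition with an injective map, as an operator on `ℓ²` spaces. -/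
def lpComp {ι κ : Type*} (σ : ι → κ) (hσ : Function.Injective σ) :
    lp (fun _ : κ => ℂ) 2 →L[ℂ] lp (fun _ : ι => ℂ) 2 :=
  LinearMap.mkContinuous
    { toFun := fun g => ⟨fun i => g (σ i), memℓp_gen
        (((memℓp_gen_iff (by norm_num)).1 (lp.memℓp g)).comp_injective hσ)⟩
      map_add' := fun f g => rfl
      map_smul' := fun c g => rfl } 1 fun g => by
    rw [one_mul]
    have h2 : 0 < (2 : ENNReal).toReal := by norm_num
    refine (Real.rpow_le_rpow_iff (norm_nonneg _) (norm_nonneg _) h2).1 ?_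
    rw [lp.norm_rpow_eq_tsum h2, lp.norm_rpow_eq_tsum h2]
    exact tsum_comp_le_tsum_of_inj ((memℓp_gen_iff h2).1 (lp.memℓp g))
      (fun _ => by positivity) hσ

@[simp]
theorem lpComp_apply {ι κ : Type*} (σ : ι → κ) (hσ : Function.Injective σ)
    (g : lp (fun _ : κ => ℂ) 2) (i : ι) : lpComp σ hσ g i = g (σ i) := rfl

theorem lpComp_single {ι κ : Type*} [DecidableEq ι] [DecidableEq κ] (σ : ι → κ)
    (hσ : Function.Injective σ) (i : ι) (a : ℂ) :
    lpComp σ hσ (lp.single 2 (σ i) a) = lp.single 2 i a := by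
  ext j
  by_cases h : j = i
  · subst h; simp
  · simp [h, hσ.ne h]

theorem lpComp_single_of_notMem_range {ι κ : Type*} [DecidableEq κ] (σ : ι → κ)
    (hσ : Function.Injective σ) (k : κ) (hk : k ∉ Set.range σ) (a : ℂ) :
    lpComp σ hσ (lp.single 2 k a) = 0 := by
  ext j
  have : σ j ≠ k := fun h => hk ⟨j, h⟩
  simp [this]

theorem adjoint_lpComp_apply {ι κ : Type*} (σ : ι → κ) (hσ : Function.Injective σ)
    (g : lp (fun _ : ι => ℂ) 2) (i : ι) : (lpComp σ hσ).adjoint g (σ i) = g i := by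
  classical
  have h1 := lp.inner_single_left (𝕜 := ℂ) (σ i) (1 : ℂ) ((lpComp σ hσ).adjoint g)
  rw [ContinuousLinearMap.adjoint_inner_right, lpComp_single, lp.inner_single_left] at h1
  simpa using h1.symm

theorem adjoint_lpComp_apply_of_notMem_range {ι κ : Type*} (σ : ι → κ)
    (hσ : Function.Injective σ) (g : lp (fun _ : ι => ℂ) 2) (k : κ) (hk : k ∉ Set.range σ) :
    (lpComp σ hσ).adjoint g k = 0 := by
  classical
  have h1 := lp.inner_single_left (𝕜 := ℂ) k (1 : ℂ) ((lpComp σ hσ).adjoint g)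
  rw [ContinuousLinearMap.adjoint_inner_right, lpComp_single_of_notMem_range _ _ _ hk] at h1
  simpa using h1.symm

/-- The adjoint extends by zero off the range of `σ`, so `lpComp` is a left inverse of it. -/
theorem norm_adjoint_lpComp_apply {ι κ : Type*} (σ : ι → κ) (hσ : Function.Injective σ)
    (g : lp (fun _ : ι => ℂ) 2) : ‖(lpComp σ hσ).adjoint g‖ = ‖g‖ := by
  have : lpComp σ hσ ((lpComp σ hσ).adjoint g) = g := by
    ext i
    rw [lpComp_apply, adjoint_lpComp_apply]
  rw [@norm_eq_sqrt_re_inner ℂ, ContinuousLinearMap.adjoint_inner_left, this,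
    ← @norm_eq_sqrt_re_inner ℂ]

theorem hasSum_norm_sq {ι : Type*} (g : lp (fun _ : ι => ℂ) 2) :
    HasSum (fun i => ‖g i‖ ^ 2) (‖g‖ ^ 2) := by
  have := lp.hasSum_norm (p := 2) (by norm_num) g
  simpa using this

/-- Compositions with maps with disjoint ranges, off a point not in the ranges. -/
theorem norm_sq_lpComp_add_le {ι κ : Type*} {σ τ : ι → κ} (hσ : Function.Injective σ)
    (hτ : Function.Injective τ) (hστ : ∀ i j, σ i ≠ τ j) {k : κ} (hkσ : ∀ i, σ i ≠ k)
    (hkτ : ∀ i, τ i ≠ k) (g : lp (fun _ : κ => ℂ) 2) :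
    ‖lpComp σ hσ g‖ ^ 2 + ‖lpComp τ hτ g‖ ^ 2 + ‖g k‖ ^ 2 ≤ ‖g‖ ^ 2 := by
  -- The three terms on the left are one sum of `‖g‖ ^ 2` over the image of a single injection.
  let ρ : (ι ⊕ ι) ⊕ Unit → κ := Sum.elim (Sum.elim σ τ) fun _ => k
  have hρ : Function.Injective ρ := by
    rintro ((a | a) | a) ((b | b) | b) h <;> simp [ρ] at h ⊢
    · exact hσ h
    · exact hστ _ _ h
    · exact hkσ _ h
    · exact hστ _ _ h.symm
    · exact hτ h
    · exact hkτ _ h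
    · exact hkσ _ h.symm
    · exact hkτ _ h.symm
  let F : (ι ⊕ ι) ⊕ Unit → ℝ := fun s => ‖g (ρ s)‖ ^ 2
  have hF : HasSum (F ∘ Sum.inl) (‖lpComp σ hσ g‖ ^ 2 + ‖lpComp τ hτ g‖ ^ 2) :=
    HasSum.sum (f := F ∘ Sum.inl) (hasSum_norm_sq (lpComp σ hσ g))
      (hasSum_norm_sq (lpComp τ hτ g))
  have h1 := HasSum.sum (f := F) hF (hasSum_unique (F ∘ Sum.inr))
  have h2 := hasSum_norm_sq g
  have h3 := tsum_comp_le_tsum_of_inj h2.summable (fun _ => by positivity) hρ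
  rw [h2.tsum_eq] at h3
  exact h1.tsum_eq.ge.trans h3

/-! ### Functionals of rank two -/

theorem isWeakStarContinuous_of_eq_add {H : Type*} [NormedAddCommGroup H] [InnerProductSpace ℂ H]
    {A : Subalgebra ℂ (H →L[ℂ] H)} (φ : StrongDual ℂ A) (x₁ x₂ y₁ y₂ : H)
    (hφ : ∀ T : A, φ T = inner ℂ y₁ ((T : H →L[ℂ] H) x₁) + inner ℂ y₂ ((T : H →L[ℂ] H) x₂)) :
    IsWeakStarContinuous φ := by
  -- Padding by zeros turns the functional into one of those that generate the topology.
  let x : ℕ → H := fun n => if n = 0 then x₁ else if n = 1 then x₂ else 0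
  let y : ℕ → H := fun n => if n = 0 then y₁ else if n = 1 then y₂ else 0
  have hx : Summable fun n => ‖x n‖ ^ 2 :=
    summable_of_ne_finset_zero (s := Finset.range 2) fun n hn => by
      have : n ≠ 0 ∧ n ≠ 1 := by simp at hn; omega
      simp [x, this]
  have hy : Summable fun n => ‖y n‖ ^ 2 :=
    summable_of_ne_finset_zero (s := Finset.range 2) fun n hn => by
      have : n ≠ 0 ∧ n ≠ 1 := by simp at hn; omega
      simp [y, this]
  have hsum : ∀ T : H →L[ℂ] H,
      ∑' n, inner ℂ (y n) (T (x n)) = inner ℂ y₁ (T x₁) + inner ℂ y₂ (T x₂) := fun T => by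
    rw [tsum_eq_sum (s := Finset.range 2) fun n hn => by
      have : n ≠ 0 ∧ n ≠ 1 := by simp at hn; omega
      simp [y, this]]
    simp [Finset.sum_range_succ, x, y]
  have hle : weakStarTopology H ≤ TopologicalSpace.induced
      (fun T : H →L[ℂ] H => ∑' n, inner ℂ (y n) (T (x n))) inferInstance :=
    iInf_le_of_le x (iInf_le_of_le y (iInf_le_of_le hx (iInf_le_of_le hy le_rfl)))
  unfold IsWeakStarContinuous
  rw [continuous_iff_le_induced]
  refine (induced_mono hle).trans (le_of_eq ?_)
  rw [induced_compose]
  congr 1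
  funext T
  simp only [Function.comp_apply, hsum, hφ]

/-- Property `𝔸₁(1)`, applied to the restriction to `A` of an operator of rank two. -/
theorem HasA11.exists_inner_eq {H : Type*} [NormedAddCommGroup H] [InnerProductSpace ℂ H]
    {A : Subalgebra ℂ (H →L[ℂ] H)} (hA : HasA11 A) (x₁ x₂ y₁ y₂ : H)
    (hxy : ‖y₁‖ * ‖x₁‖ + ‖y₂‖ * ‖x₂‖ < 1) :
    ∃ ξ η : H, ‖ξ‖ < 1 ∧ ‖η‖ < 1 ∧
      ∀ T ∈ A, inner ℂ η (T ξ) = inner ℂ y₁ (T x₁) + inner ℂ y₂ (T x₂) := by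
  let L : A →ₗ[ℂ] ℂ :=
    { toFun := fun T => inner ℂ y₁ ((T : H →L[ℂ] H) x₁) + inner ℂ y₂ ((T : H →L[ℂ] H) x₂)
      map_add' := fun S T => by simp; ring
      map_smul' := fun a T => by simp; ring }
  have hy : ∀ (T : A) (x y : H), ‖inner ℂ y ((T : H →L[ℂ] H) x)‖ ≤ ‖y‖ * ‖x‖ * ‖T‖ :=
    fun T x y => by
      refine (norm_inner_le_norm _ _).trans ?_
      rw [mul_assoc, mul_comm ‖x‖]
      exact mul_le_mul_of_nonneg_left ((T : H →L[ℂ] H).le_opNorm x) (norm_nonneg _)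
  have hL : ∀ T, ‖L T‖ ≤ (‖y₁‖ * ‖x₁‖ + ‖y₂‖ * ‖x₂‖) * ‖T‖ := fun T => by
    rw [add_mul]
    exact (norm_add_le _ _).trans (add_le_add (hy T x₁ y₁) (hy T x₂ y₂))
  let φ : StrongDual ℂ A := L.mkContinuous _ hL
  obtain ⟨ξ, η, hξ, hη, h⟩ := hA φ
    (isWeakStarContinuous_of_eq_add φ x₁ x₂ y₁ y₂ fun T => rfl)
    ((L.mkContinuous_norm_le (by positivity) hL).trans_lt hxy)
  exact ⟨ξ, η, hξ, hη, fun T hT => (h ⟨T, hT⟩).symm⟩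

/-! ### A criterion for the failure of 𝔸₁(1) -/

theorem opOfMatrix_single_apply {H : Type*} [NormedAddCommGroup H] [InnerProductSpace ℂ H] {k : ℕ}
    (i j : Fin k) (a : H →L[ℂ] H) (ξ : PiLp 2 (fun _ : Fin k => H)) :
    opOfMatrix (Matrix.single i j a) ξ = PiLp.single 2 i (a (ξ j)) := by
  ext l
  rw [opOfMatrix_apply, Finset.sum_eq_single j]
  · by_cases h : l = i
    · subst h; simp
    · simp [Matrix.single_apply_of_row_ne (Ne.symm h), h]
  · intro b _ hb
    simp [Matrix.single_apply_of_col_ne _ _ (Ne.symm hb)]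
  · simp

theorem opOfMatrix_single_mem {H : Type*} [NormedAddCommGroup H] [InnerProductSpace ℂ H] {k : ℕ}
    {A : Subalgebra ℂ (H →L[ℂ] H)} (i j : Fin k) {a : H →L[ℂ] H} (ha : a ∈ A) :
    opOfMatrix (Matrix.single i j a) ∈ matrixAlgebra k A := by
  refine ⟨_, fun i' j' => ?_, rfl⟩
  rw [Matrix.single_apply]
  split_ifs
  · exact ha
  · exact A.zero_mem

/-- The cross term `⟨e, q⟩ p - ⟨e, p⟩ q` is small if `p` and `q` are close to multiples of `e`. -/
theorem norm_sq_inner_smul_sub_inner_smul_le {H : Type*} [NormedAddCommGroup H]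
    [InnerProductSpace ℂ H] {e : H} (he : ‖e‖ = 1) (p q : H) :
    ‖inner ℂ e q • p - inner ℂ e p • q‖ ^ 2 ≤
      (‖inner ℂ e p‖ ^ 2 + ‖inner ℂ e q‖ ^ 2) *
        (‖p‖ ^ 2 + ‖q‖ ^ 2 - (‖inner ℂ e p‖ ^ 2 + ‖inner ℂ e q‖ ^ 2)) := by
  have hres : ∀ f : H, ‖f - inner ℂ e f • e‖ ^ 2 = ‖f‖ ^ 2 - ‖inner ℂ e f‖ ^ 2 := fun f => by
    rw [@norm_sub_sq ℂ, inner_smul_right, norm_smul, he, ← inner_conj_symm f e, Complex.mul_conj,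
      Complex.normSq_eq_norm_sq]
    simp only [RCLike.re_to_complex, Complex.ofReal_re]
    ring
  -- The components along `e` cancel, so only the residuals of `p` and `q` orthogonal to `e`
  -- contribute.
  have hu : inner ℂ e q • p - inner ℂ e p • q =
      inner ℂ e q • (p - inner ℂ e p • e) - inner ℂ e p • (q - inner ℂ e q • e) := by
    simp only [smul_sub, smul_smul, mul_comm (inner ℂ e p)]
    abel
  have hn : ‖inner ℂ e q • p - inner ℂ e p • q‖ ≤
      ‖inner ℂ e q‖ * ‖p - inner ℂ e p • e‖ + ‖inner ℂ e p‖ * ‖q - inner ℂ e q • e‖ := by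
    rw [hu, ← norm_smul, ← norm_smul]
    exact norm_sub_le _ _
  have hp := hres p
  have hq := hres q
  set a := ‖inner ℂ e p‖
  set b := ‖inner ℂ e q‖
  set r := ‖p - inner ℂ e p • e‖
  set s := ‖q - inner ℂ e q • e‖
  calc _ ≤ (b * r + a * s) ^ 2 := pow_le_pow_left₀ (norm_nonneg _) hn 2
    _ ≤ (a ^ 2 + b ^ 2) * (r ^ 2 + s ^ 2) := by nlinarith [sq_nonneg (a * r - b * s)]
    _ = _ := by rw [hp, hq]; ring

/-- The two vectors are orthogonal, so the norm is √2; `71 / 50` is a rational upper bound. -/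
theorem norm_single_add_single_le {H : Type*} [NormedAddCommGroup H] [InnerProductSpace ℂ H]
    {k : ℕ} {i j : Fin k} (hij : i ≠ j) {a b : H} (ha : ‖a‖ = 1) (hb : ‖b‖ = 1) :
    ‖PiLp.single 2 (β := fun _ : Fin k => H) i a + PiLp.single 2 j b‖ ≤ 71 / 50 := by
  refine (sq_le_sq₀ (norm_nonneg _) (by norm_num)).1 ?_
  have h : inner ℂ (PiLp.single 2 (β := fun _ : Fin k => H) i a) (PiLp.single 2 j b) = 0 := by
    rw [PiLp.inner_apply]
    refine Finset.sum_eq_zero fun l _ => ?_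
    by_cases hl : l = i
    · subst hl; simp [hij]
    · simp [hl]
  rw [@norm_add_sq ℂ, h]
  simp [ha, hb]
  norm_num

/-- If `A` contains operators `Z`, `W` that are isometric on the line through `e` and jointly
strictly less than isometric off that line, then the `6 × 6` matrices over `A` fail `𝔸₁(1)`. -/
theorem not_hasA11_matrixAlgebra {H : Type*} [NormedAddCommGroup H] [InnerProductSpace ℂ H]
    {A : Subalgebra ℂ (H →L[ℂ] H)} {Z W : H →L[ℂ] H} (hZ : Z ∈ A) (hW : W ∈ A) {e : H}
    (he : ‖e‖ = 1) (hZe : ‖Z e‖ = 1) (hWe : ‖W e‖ = 1) (hZ1 : ∀ f, ‖Z f‖ ≤ ‖f‖)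
    (hZW : ∀ f, ‖Z f‖ ^ 2 + ‖W f‖ ^ 2 ≤ 3 / 2 * ‖f‖ ^ 2 + 1 / 2 * ‖inner ℂ e f‖ ^ 2) :
    ¬ HasA11 (matrixAlgebra 6 A) := by
  intro hA
  let x₁ : PiLp 2 (fun _ : Fin 6 => H) := PiLp.single 2 0 e
  let x₂ : PiLp 2 (fun _ : Fin 6 => H) := PiLp.single 2 1 e
  let y₁ : PiLp 2 (fun _ : Fin 6 => H) := PiLp.single 2 0 (Z e) + PiLp.single 2 2 (W e)
  let y₂ : PiLp 2 (fun _ : Fin 6 => H) := PiLp.single 2 1 (Z e) + PiLp.single 2 3 (W e)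
  have hx₁ : ‖x₁‖ = 1 := (PiLp.norm_single ..).trans he
  have hx₂ : ‖x₂‖ = 1 := (PiLp.norm_single ..).trans he
  have hy₁ : ‖y₁‖ ≤ 71 / 50 := norm_single_add_single_le (by decide) hZe hWe
  have hy₂ : ‖y₂‖ ≤ 71 / 50 := norm_single_add_single_le (by decide) hZe hWe
  -- Just below 1/(2√2): the norm bound 2 · (7/20) · (71/50) = 0.994 stays below 1.
  let c : ℂ := (7 / 20 : ℝ)
  have hc : ‖c‖ = 7 / 20 := by simp [c]
  have hc' : starRingEnd ℂ c = c := Complex.conj_ofReal _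
  obtain ⟨ξ, η, hξ, hη, h⟩ := hA.exists_inner_eq x₁ x₂ (c • y₁) (c • y₂) (by
    rw [norm_smul, norm_smul, hc, hx₁, hx₂]
    linarith)
  -- Testing on matrix units separates the single equation into one for each entry.
  have key : ∀ (i j : Fin 6) (a : H →L[ℂ] H), a ∈ A → inner ℂ (η i) (a (ξ j)) =
      c * (inner ℂ (y₁ i) (a (x₁ j)) + inner ℂ (y₂ i) (a (x₂ j))) := fun i j a ha => by
    have := h _ (opOfMatrix_single_mem i j ha)
    have hs : ∀ (y : PiLp 2 (fun _ : Fin 6 => H)) (b : H), inner ℂ y (PiLp.single 2 i b) = inner ℂ (y i) b :=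
      fun y b => by
        rw [PiLp.inner_apply, Finset.sum_eq_single i]
        · simp
        · intro l _ hl; simp [hl]
        · simp
    simp only [opOfMatrix_single_apply, hs, PiLp.smul_apply, inner_smul_left, hc'] at this
    rw [this, mul_add]
  have e00 : inner ℂ (η 0) (Z (ξ 0)) = c := by
    rw [key 0 0 Z hZ]; simp [x₁, x₂, y₁, y₂, hZe]
  have e20 : inner ℂ (η 2) (W (ξ 0)) = c := by
    rw [key 2 0 W hW]; simp [x₁, x₂, y₁, y₂, hWe]
  have e11 : inner ℂ (η 1) (Z (ξ 1)) = c := by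
    rw [key 1 1 Z hZ]; simp [x₁, x₂, y₁, y₂, hZe]
  have e31 : inner ℂ (η 3) (W (ξ 1)) = c := by
    rw [key 3 1 W hW]; simp [x₁, x₂, y₁, y₂, hWe]
  have e01 : inner ℂ (η 0) (Z (ξ 1)) = 0 := by
    rw [key 0 1 Z hZ]; simp [x₁, x₂, y₁, y₂]
  have e10 : inner ℂ (η 1) (Z (ξ 0)) = 0 := by
    rw [key 1 0 Z hZ]; simp [x₁, x₂, y₁, y₂]
  have hξ2 : ‖ξ 0‖ ^ 2 + ‖ξ 1‖ ^ 2 ≤ 1 := by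
    have h1 : ‖ξ‖ ^ 2 ≤ 1 := pow_le_one₀ (norm_nonneg _) hξ.le
    rw [PiLp.norm_sq_eq_of_L2, Fin.sum_univ_six] at h1
    nlinarith [sq_nonneg ‖ξ 2‖, sq_nonneg ‖ξ 3‖, sq_nonneg ‖ξ 4‖, sq_nonneg ‖ξ 5‖]
  have hη2 : ‖η 0‖ ^ 2 + ‖η 1‖ ^ 2 + ‖η 2‖ ^ 2 + ‖η 3‖ ^ 2 ≤ 1 := by
    have h1 : ‖η‖ ^ 2 ≤ 1 := pow_le_one₀ (norm_nonneg _) hη.le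
    rw [PiLp.norm_sq_eq_of_L2, Fin.sum_univ_six] at h1
    nlinarith [sq_nonneg ‖η 4‖, sq_nonneg ‖η 5‖]
  have hle : ∀ {i : Fin 6} {v : H}, inner ℂ (η i) v = c → 7 / 20 ≤ ‖η i‖ * ‖v‖ := fun {i v} hi =>
    hc ▸ hi ▸ norm_inner_le_norm (η i) v
  set m := ‖inner ℂ e (ξ 0)‖ ^ 2 + ‖inner ℂ e (ξ 1)‖ ^ 2 with hm
  -- Cauchy–Schwarz on the four equations with value `c` gives (4c)² = 49/25 ≤ 3/2 + m/2.
  have hm1 : 23 / 25 ≤ m := by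
    have a0 := hle e00
    have a1 := hle e11
    have a2 := hle e20
    have a3 := hle e31
    have b0 := hZW (ξ 0)
    have b1 := hZW (ξ 1)
    have cs := Finset.sum_mul_sq_le_sq_mul_sq Finset.univ
      ![‖η 0‖, ‖η 1‖, ‖η 2‖, ‖η 3‖] ![‖Z (ξ 0)‖, ‖Z (ξ 1)‖, ‖W (ξ 0)‖, ‖W (ξ 1)‖]
    simp only [Fin.sum_univ_four, Matrix.cons_val] at cs
    have hs : (7 / 5 : ℝ) ^ 2 ≤ (‖η 0‖ * ‖Z (ξ 0)‖ + ‖η 1‖ * ‖Z (ξ 1)‖ + ‖η 2‖ * ‖W (ξ 0)‖ +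
        ‖η 3‖ * ‖W (ξ 1)‖) ^ 2 := pow_le_pow_left₀ (by norm_num) (by linarith) 2
    have := hs.trans (cs.trans (mul_le_of_le_one_left (by positivity) hη2))
    linarith
  set u := inner ℂ e (ξ 1) • ξ 0 - inner ℂ e (ξ 0) • ξ 1 with hu
  have hu2 : ‖u‖ ^ 2 ≤ m * (1 - m) :=
    (norm_sq_inner_smul_sub_inner_smul_le he (ξ 0) (ξ 1)).trans
      (mul_le_mul_of_nonneg_left (by linarith) (by positivity))
  -- The vanishing cross terms leave one summand of ⟨Zu, η₀⟩, and likewise of ⟨Zu, η₁⟩ below,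
  -- although `u` is small.
  have hb : ‖inner ℂ e (ξ 1)‖ * (7 / 20) ≤ ‖η 0‖ * ‖u‖ := by
    have h1 : inner ℂ (η 0) (Z u) = inner ℂ e (ξ 1) * c := by
      simp [hu, e00, e01]
    rw [← hc, ← norm_mul, ← h1]
    exact (norm_inner_le_norm _ _).trans (mul_le_mul_of_nonneg_left (hZ1 u) (norm_nonneg _))
  have ha : ‖inner ℂ e (ξ 0)‖ * (7 / 20) ≤ ‖η 1‖ * ‖u‖ := by
    have h1 : inner ℂ (η 1) (Z u) = -(inner ℂ e (ξ 0) * c) := by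
      simp [hu, e11, e10]
    rw [← hc, ← norm_mul, ← norm_neg, ← h1]
    exact (norm_inner_le_norm _ _).trans (mul_le_mul_of_nonneg_left (hZ1 u) (norm_nonneg _))
  have ha2 := pow_le_pow_left₀ (by positivity) ha 2
  have hb2 := pow_le_pow_left₀ (by positivity) hb 2
  rw [mul_pow, mul_pow] at ha2 hb2
  -- Adding the squares of `ha` and `hb` gives c²m ≤ ‖u‖². Hence 49/400 ≤ 1 - m, against 1 - m ≤
  -- 2/25.
  have h1 : m * (49 / 400) ≤ m * (1 - m) := by
    refine le_trans ?_ hu2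
    have : (‖η 0‖ ^ 2 + ‖η 1‖ ^ 2) * ‖u‖ ^ 2 ≤ ‖u‖ ^ 2 :=
      mul_le_of_le_one_left (by positivity) (by nlinarith [sq_nonneg ‖η 2‖, sq_nonneg ‖η 3‖])
    linarith
  nlinarith [le_of_mul_le_mul_left h1 (by linarith)]

/-! ### The Drury–Arveson kernel in the full Fock space -/

/-- The noncommutative multinomial expansion of the geometric series. -/
theorem hasSum_list_prod_map {ι : Type*} [Fintype ι] (a : ι → ℂ) (ha : ∑ i, ‖a i‖ < 1) :
    HasSum (fun l : List ι => (l.map a).prod) (1 - ∑ i, a i)⁻¹ := by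
  have hprod : ∀ b : ι → ℂ, ∀ n, ∀ p : Fin n → ι,
      ((List.equivSigmaTuple.symm ⟨n, p⟩).map b).prod = ∏ i, b (p i) := fun b n p => by
    simp [List.equivSigmaTuple, List.map_ofFn, List.prod_ofFn]
  rw [← List.equivSigmaTuple.symm.hasSum_iff]
  have hn : ∀ n, HasSum (fun p : Fin n → ι =>
      ((fun l : List ι => (l.map a).prod) ∘ List.equivSigmaTuple.symm) ⟨n, p⟩)
      ((∑ i, a i) ^ n) := fun n => by
    simp only [Function.comp_apply, hprod, Fintype.sum_pow]
    exact hasSum_fintype _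
  have hlt : ‖∑ i, a i‖ < 1 := (norm_sum_le _ _).trans_lt ha
  have hs : Summable ((fun l : List ι => (l.map a).prod) ∘ List.equivSigmaTuple.symm) := by
    -- Words of length n contribute (∑ ‖a i‖)ⁿ in absolute value; this is why `ha` bounds the sum of
    -- norms.
    refine Summable.of_norm ((summable_sigma_of_nonneg fun _ => norm_nonneg _).2 ⟨fun n => ?_, ?_⟩)
    · exact (hasSum_fintype _).summable
    · refine (summable_geometric_of_lt_one (by positivity) ha).congr fun n => ?_
      simp only [Function.comp_apply, hprod, norm_prod, tsum_fintype, Fintype.sum_pow]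
  have h1 := hs.hasSum.sigma hn
  rw [← h1.unique (hasSum_geometric_of_norm_lt_one hlt)]
  exact hs.hasSum

theorem sum_norm_mul_lt_one {d : ℕ} (z w : UnitBall d) :
    ∑ i, ‖(z : EuclideanSpace ℂ (Fin d)) i‖ * ‖(w : EuclideanSpace ℂ (Fin d)) i‖ < 1 := by
  have hz : ‖(z : EuclideanSpace ℂ (Fin d))‖ ^ 2 < 1 :=
    pow_lt_one₀ (norm_nonneg _) (mem_ball_zero_iff.mp z.2) (by norm_num)
  have hw : ‖(w : EuclideanSpace ℂ (Fin d))‖ ^ 2 < 1 :=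
    pow_lt_one₀ (norm_nonneg _) (mem_ball_zero_iff.mp w.2) (by norm_num)
  rw [EuclideanSpace.norm_sq_eq] at hz hw
  have : ∀ i ∈ Finset.univ, ‖(z : EuclideanSpace ℂ (Fin d)) i‖ *
      ‖(w : EuclideanSpace ℂ (Fin d)) i‖ ≤ (‖(z : EuclideanSpace ℂ (Fin d)) i‖ ^ 2 +
      ‖(w : EuclideanSpace ℂ (Fin d)) i‖ ^ 2) / 2 := fun i _ => by
    nlinarith [sq_nonneg (‖(z : EuclideanSpace ℂ (Fin d)) i‖ -
      ‖(w : EuclideanSpace ℂ (Fin d)) i‖)]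
  refine (Finset.sum_le_sum this).trans_lt ?_
  rw [← Finset.sum_div, Finset.sum_add_distrib]
  linarith

/-- The full Fock space over `ℂ^d`, with the words in `d` letters as orthonormal basis. -/
abbrev Fock (d : ℕ) : Type := lp (fun _ : List (Fin d) => ℂ) 2

/-- The feature vector of the Drury–Arveson kernel in the full Fock space. -/
def fockKernel {d : ℕ} (w : UnitBall d) : Fock d :=
  ⟨fun l => starRingEnd ℂ (l.map (w : EuclideanSpace ℂ (Fin d))).prod, memℓp_gen <| by
    -- The squared moduli of the coefficients are the word products of the numbers |w_i|².
    have h := (hasSum_list_prod_map (fun i => ((‖(w : EuclideanSpace ℂ (Fin d)) i‖ *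
      ‖(w : EuclideanSpace ℂ (Fin d)) i‖ : ℝ) : ℂ)) (by simpa using sum_norm_mul_lt_one w w)).summable
    refine h.norm.congr fun l => ?_
    induction l with
    | nil => simp
    | cons i l ih =>
      simp only [List.map_cons, List.prod_cons, norm_mul, map_mul] at ih ⊢
      rw [Real.mul_rpow (by positivity) (by positivity), ih]
      simp [sq]⟩

theorem fockKernel_apply {d : ℕ} (w : UnitBall d) (l : List (Fin d)) :
    fockKernel w l = starRingEnd ℂ (l.map (w : EuclideanSpace ℂ (Fin d))).prod := rfl

theorem inner_fockKernel {d : ℕ} (z w : UnitBall d) : inner ℂ (fockKernel z) (fockKernel w) =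
    (1 - inner ℂ (w : EuclideanSpace ℂ (Fin d)) (z : EuclideanSpace ℂ (Fin d)))⁻¹ := by
  have h := hasSum_list_prod_map (fun i => (z : EuclideanSpace ℂ (Fin d)) i *
    starRingEnd ℂ ((w : EuclideanSpace ℂ (Fin d)) i)) (by simpa using sum_norm_mul_lt_one z w)
  rw [PiLp.inner_apply]
  simp only [RCLike.inner_apply]
  refine (lp.hasSum_inner (𝕜 := ℂ) (fockKernel z) (fockKernel w)).unique (h.congr_fun ?_)
  intro l
  simp only [fockKernel_apply, RCLike.inner_apply, Complex.conj_conj]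
  induction l with
  | nil => simp
  | cons i l ih =>
    simp only [List.map_cons, List.prod_cons, map_mul] at ih ⊢
    rw [← ih]
    ring

theorem inner_kerFun_druryArveson {d : ℕ} (z w : UnitBall d) :
    inner ℂ (RKHS.kerFun (DruryArveson d) z 1) (RKHS.kerFun (DruryArveson d) w 1) =
      (1 - inner ℂ (w : EuclideanSpace ℂ (Fin d)) (z : EuclideanSpace ℂ (Fin d)))⁻¹ := by
  rw [RKHS.kerFun_inner, RKHS.kerFun_apply, kernel_druryArveson]
  simp [druryArvesonKernel]

theorem dense_span_kerFun_druryArveson (d : ℕ) : Dense (Submodule.span ℂ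
    (Set.range fun w : UnitBall d => RKHS.kerFun (DruryArveson d) w 1) : Set (DruryArveson d)) := by
  have h := RKHS.kerFun_dense (DruryArveson d)
  rw [Submodule.dense_iff_topologicalClosure_eq_top, eq_top_iff, ← h]
  refine Submodule.topologicalClosure_mono (Submodule.span_le.2 ?_)
  rintro _ ⟨w, v, rfl⟩
  have : RKHS.kerFun (DruryArveson d) w v = v • RKHS.kerFun (DruryArveson d) w 1 := by
    rw [← map_smul, smul_eq_mul, mul_one]
  rw [this]
  exact Submodule.smul_mem _ _ (Submodule.subset_span ⟨w, rfl⟩)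

theorem exists_linearIsometry_fock (d : ℕ) : ∃ U : DruryArveson d →ₗᵢ[ℂ] Fock d,
    ∀ w, U (RKHS.kerFun (DruryArveson d) w 1) = fockKernel w :=
  exists_linearIsometry_of_inner_eq _ _ (dense_span_kerFun_druryArveson d) fun z w => by
    rw [inner_kerFun_druryArveson, inner_fockKernel]

/-! ### Creation and annihilation operators -/

/-- The adjoint of the left creation operator of the letter `i`. -/
def leftAnnihilation {d : ℕ} (i : Fin d) : Fock d →L[ℂ] Fock d :=
  lpComp (List.cons i) List.cons_injective

/-- The adjoint of the right creation operator of the letter `i`. -/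
def rightAnnihilation {d : ℕ} (i : Fin d) : Fock d →L[ℂ] Fock d :=
  lpComp (fun l => l ++ [i]) (List.append_left_injective [i])

theorem leftAnnihilation_fockKernel {d : ℕ} (i : Fin d) (w : UnitBall d) :
    leftAnnihilation i (fockKernel w) =
      starRingEnd ℂ ((w : EuclideanSpace ℂ (Fin d)) i) • fockKernel w := by
  ext l
  simp [leftAnnihilation, fockKernel_apply]

theorem rightAnnihilation_fockKernel {d : ℕ} (i : Fin d) (w : UnitBall d) :
    rightAnnihilation i (fockKernel w) =
      starRingEnd ℂ ((w : EuclideanSpace ℂ (Fin d)) i) • fockKernel w := by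
  ext l
  simp [rightAnnihilation, fockKernel_apply, mul_comm]

/-- Removing the first letter commutes with appending a last one, except that on the empty word the
appended letter is itself the first; this gives the vacuum term. -/
theorem leftAnnihilation_adjoint_rightAnnihilation {d : ℕ} (i : Fin d) (g : Fock d) :
    leftAnnihilation i ((rightAnnihilation i).adjoint g) =
      (rightAnnihilation i).adjoint (leftAnnihilation i g) + lp.single 2 [] (g []) := by
  ext l
  simp only [leftAnnihilation, rightAnnihilation, lpComp_apply, lp.coeFn_add, Pi.add_apply]
  rcases List.eq_nil_or_concat' l with rfl | ⟨l, j, rfl⟩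
  · have h := adjoint_lpComp_apply _ (List.append_left_injective [i]) g []
    rw [List.nil_append] at h
    rw [h, adjoint_lpComp_apply_of_notMem_range]
    · simp
    · rintro ⟨l, hl⟩
      simp at hl
  · by_cases hj : j = i
    · subst hj
      rw [← List.cons_append]
      have h := adjoint_lpComp_apply _ (List.append_left_injective [j]) g (j :: l)
      have h' := adjoint_lpComp_apply _ (List.append_left_injective [j])
        (lpComp (List.cons j) List.cons_injective g) l
      rw [h, h']
      simp
    · rw [adjoint_lpComp_apply_of_notMem_range, adjoint_lpComp_apply_of_notMem_range]
      · simp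
      · rintro ⟨l', hl'⟩
        exact hj (by simpa using (congrArg List.getLast? hl').symm)
      · rintro ⟨l', hl'⟩
        rw [← List.cons_append] at hl'
        exact hj (by simpa using (List.append_inj_right' hl' rfl).symm)

/-- On symmetric vectors, the mean of the two creation operators is far from isometric. -/
theorem norm_sq_adjoint_add_adjoint {d : ℕ} (i : Fin d) {g : Fock d}
    (hg : rightAnnihilation i g = leftAnnihilation i g) :
    ‖(leftAnnihilation i).adjoint g + (rightAnnihilation i).adjoint g‖ ^ 2 =
      2 * (‖g‖ ^ 2 + ‖leftAnnihilation i g‖ ^ 2 + ‖g []‖ ^ 2) := by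
  have h : inner ℂ ((leftAnnihilation i).adjoint g) ((rightAnnihilation i).adjoint g) =
      ((‖leftAnnihilation i g‖ ^ 2 + ‖g []‖ ^ 2 : ℝ) : ℂ) := by
    rw [ContinuousLinearMap.adjoint_inner_left, leftAnnihilation_adjoint_rightAnnihilation,
      inner_add_right, ContinuousLinearMap.adjoint_inner_right, hg, lp.inner_single_right,
      inner_self_eq_norm_sq_to_K, inner_self_eq_norm_sq_to_K]
    simp
  rw [@norm_add_sq ℂ, h, RCLike.re_to_complex, Complex.ofReal_re]
  have hl : ‖(leftAnnihilation i).adjoint g‖ = ‖g‖ := norm_adjoint_lpComp_apply _ _ g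
  have hr : ‖(rightAnnihilation i).adjoint g‖ = ‖g‖ := norm_adjoint_lpComp_apply _ _ g
  rw [hl, hr]
  ring

/-! ### Coordinate multipliers as compressions -/

/-- The isometric embedding of the Drury–Arveson space into the full Fock space. -/
def fockEmbedding (d : ℕ) : DruryArveson d →ₗᵢ[ℂ] Fock d :=
  (exists_linearIsometry_fock d).choose

@[simp]
theorem fockEmbedding_kerFun {d : ℕ} (w : UnitBall d) :
    fockEmbedding d (RKHS.kerFun (DruryArveson d) w 1) = fockKernel w :=
  (exists_linearIsometry_fock d).choose_spec w

theorem inner_fockKernel_fockEmbedding {d : ℕ} (w : UnitBall d) (f : DruryArveson d) :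
    inner ℂ (fockKernel w) (fockEmbedding d f) = f w := by
  rw [← fockEmbedding_kerFun, LinearIsometry.inner_map_map, RKHS.kerFun_inner]
  simp

/-- Both operators have the kernel vectors as eigenvectors with the same eigenvalues, and these
vectors span a dense subspace. -/
theorem rightAnnihilation_fockEmbedding {d : ℕ} (i : Fin d) (f : DruryArveson d) :
    rightAnnihilation i (fockEmbedding d f) = leftAnnihilation i (fockEmbedding d f) := by
  have h : rightAnnihilation i ∘L (fockEmbedding d).toContinuousLinearMap =
      leftAnnihilation i ∘L (fockEmbedding d).toContinuousLinearMap := by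
    refine ContinuousLinearMap.ext_on (dense_span_kerFun_druryArveson d) ?_
    rintro _ ⟨w, rfl⟩
    simp [leftAnnihilation_fockKernel, rightAnnihilation_fockKernel]
  exact congrArg (fun T => T f) h

/-- Compressions of adjoints of operators with eigenvectors `fockKernel w` are multiplications. -/
theorem adjoint_fockEmbedding_apply {d : ℕ} (i : Fin d) {B : Fock d →L[ℂ] Fock d}
    (hB : ∀ w : UnitBall d, B (fockKernel w) =
      starRingEnd ℂ ((w : EuclideanSpace ℂ (Fin d)) i) • fockKernel w)
    (f : DruryArveson d) (w : UnitBall d) :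
    ((fockEmbedding d).toContinuousLinearMap.adjoint (B.adjoint (fockEmbedding d f))) w =
      (w : EuclideanSpace ℂ (Fin d)) i * f w := by
  rw [← inner_fockKernel_fockEmbedding w f]
  have h := RKHS.kerFun_inner (𝕜 := ℂ) w (1 : ℂ)
    ((fockEmbedding d).toContinuousLinearMap.adjoint (B.adjoint (fockEmbedding d f)))
  rw [ContinuousLinearMap.adjoint_inner_right, LinearIsometry.coe_toContinuousLinearMap,
    fockEmbedding_kerFun, ContinuousLinearMap.adjoint_inner_right, hB, inner_smul_left,
    Complex.conj_conj] at h
  simpa using h.symm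

/-- The operator of multiplication by the `i`-th coordinate on the Drury–Arveson space. -/
def coordMul {d : ℕ} (i : Fin d) : DruryArveson d →L[ℂ] DruryArveson d :=
  (fockEmbedding d).toContinuousLinearMap.adjoint ∘L (leftAnnihilation i).adjoint ∘L
    (fockEmbedding d).toContinuousLinearMap

theorem coordMul_apply_eq_left {d : ℕ} (i : Fin d) (f : DruryArveson d) : coordMul i f =
    (fockEmbedding d).toContinuousLinearMap.adjoint
      ((leftAnnihilation i).adjoint (fockEmbedding d f)) := rfl

theorem coordMul_apply {d : ℕ} (i : Fin d) (f : DruryArveson d) (w : UnitBall d) :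
    coordMul i f w = (w : EuclideanSpace ℂ (Fin d)) i * f w :=
  adjoint_fockEmbedding_apply i (leftAnnihilation_fockKernel i) f w

theorem coordMul_apply_eq_right {d : ℕ} (i : Fin d) (f : DruryArveson d) : coordMul i f =
    (fockEmbedding d).toContinuousLinearMap.adjoint
      ((rightAnnihilation i).adjoint (fockEmbedding d f)) := by
  ext w
  rw [coordMul_apply, adjoint_fockEmbedding_apply i (rightAnnihilation_fockKernel i)]

theorem coordMul_mem {d : ℕ} (i : Fin d) : coordMul i ∈ multiplierAlgebra (DruryArveson d) :=
  ⟨fun w => (w : EuclideanSpace ℂ (Fin d)) i, fun f => ⟨coordMul i f, coordMul_apply i f⟩,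
    coordMul_apply i⟩

theorem norm_adjoint_fockEmbedding_le {d : ℕ} (g : Fock d) :
    ‖(fockEmbedding d).toContinuousLinearMap.adjoint g‖ ≤ ‖g‖ := by
  refine (ContinuousLinearMap.le_opNorm _ _).trans (mul_le_of_le_one_left (norm_nonneg _) ?_)
  rw [LinearIsometryEquiv.norm_map]
  exact (fockEmbedding d).norm_toContinuousLinearMap_le

theorem norm_coordMul_le {d : ℕ} (i : Fin d) (f : DruryArveson d) : ‖coordMul i f‖ ≤ ‖f‖ := by
  rw [coordMul_apply_eq_left]
  refine (norm_adjoint_fockEmbedding_le _).trans (le_of_eq ?_)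
  exact (norm_adjoint_lpComp_apply _ _ _).trans (LinearIsometry.norm_map _ _)

/-! ### Norm estimates for the coordinate multipliers -/

/-- The constant function `1` in the Drury–Arveson space. -/
def druryArvesonOne (d : ℕ) : DruryArveson d :=
  RKHS.kerFun (DruryArveson d) ⟨0, Metric.mem_ball_self one_pos⟩ 1

theorem druryArvesonOne_apply {d : ℕ} (w : UnitBall d) : druryArvesonOne d w = 1 := by
  rw [druryArvesonOne, RKHS.kerFun_apply, kernel_druryArveson]
  simp [druryArvesonKernel]

theorem norm_druryArvesonOne (d : ℕ) : ‖druryArvesonOne d‖ = 1 := by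
  rw [@norm_eq_sqrt_re_inner ℂ, druryArvesonOne, inner_kerFun_druryArveson]
  simp

theorem fockEmbedding_apply_nil {d : ℕ} (f : DruryArveson d) :
    fockEmbedding d f [] = inner ℂ (druryArvesonOne d) f := by
  have h : fockEmbedding d (druryArvesonOne d) = lp.single 2 [] 1 := by
    rw [druryArvesonOne, fockEmbedding_kerFun]
    ext l
    rw [fockKernel_apply]
    cases l <;> simp
  rw [← LinearIsometry.inner_map_map (fockEmbedding d), h, lp.inner_single_left]
  simp

theorem norm_sq_coordMul_le {d : ℕ} (i : Fin d) (f : DruryArveson d) : ‖coordMul i f‖ ^ 2 ≤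
    1 / 2 * (‖f‖ ^ 2 + ‖leftAnnihilation i (fockEmbedding d f)‖ ^ 2 +
      ‖fockEmbedding d f []‖ ^ 2) := by
  -- Averaging the two compressions is what improves on the trivial contraction bound.
  have h2 : (2 : ℂ) • coordMul i f = (fockEmbedding d).toContinuousLinearMap.adjoint
      ((leftAnnihilation i).adjoint (fockEmbedding d f) +
        (rightAnnihilation i).adjoint (fockEmbedding d f)) := by
    rw [map_add, ← coordMul_apply_eq_left, ← coordMul_apply_eq_right, two_smul]
  have h := norm_adjoint_fockEmbedding_le ((leftAnnihilation i).adjoint (fockEmbedding d f) +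
        (rightAnnihilation i).adjoint (fockEmbedding d f))
  rw [← h2, norm_smul, Complex.norm_ofNat] at h
  have h3 := pow_le_pow_left₀ (by positivity) h 2
  rw [norm_sq_adjoint_add_adjoint i (rightAnnihilation_fockEmbedding i f),
    LinearIsometry.norm_map] at h3
  linarith

/-- Words starting with `i`, words starting with `j` and the empty word are disjoint, so the two
annihilated parts have total squared norm at most ‖f‖² - |⟨f, 1⟩|². -/
theorem norm_sq_coordMul_add_le {d : ℕ} {i j : Fin d} (hij : i ≠ j) (f : DruryArveson d) :
    ‖coordMul i f‖ ^ 2 + ‖coordMul j f‖ ^ 2 ≤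
      3 / 2 * ‖f‖ ^ 2 + 1 / 2 * ‖inner ℂ (druryArvesonOne d) f‖ ^ 2 := by
  have h := norm_sq_lpComp_add_le (σ := List.cons i) (τ := List.cons j) (k := [])
    List.cons_injective List.cons_injective (by simp [hij]) (by simp) (by simp)
    (fockEmbedding d f)
  change ‖leftAnnihilation i _‖ ^ 2 + ‖leftAnnihilation j _‖ ^ 2 + _ ≤ _ at h
  rw [LinearIsometry.norm_map] at h
  rw [← fockEmbedding_apply_nil]
  linarith [norm_sq_coordMul_le i f, norm_sq_coordMul_le j f]

theorem norm_coordMul_one {d : ℕ} (i : Fin d) : ‖coordMul i (druryArvesonOne d)‖ = 1 := by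
  refine le_antisymm ((norm_coordMul_le i _).trans (norm_druryArvesonOne d).le) ?_
  set N := ‖coordMul i (druryArvesonOne d)‖ with hN
  -- Pair z_i with k_w - 1 at w = r e_i. Since z_i ⟂ 1, subtracting 1 keeps the pairing equal to r
  -- and lowers the squared norm to r²/(1 - r²), which makes the bound sharp as r → 0.
  have key : ∀ r : ℝ, 0 < r → r < 1 → 1 - r ^ 2 ≤ N ^ 2 := fun r h0 h1 => by
    have hr : EuclideanSpace.single i (r : ℂ) ∈ Metric.ball (0 : EuclideanSpace ℂ (Fin d)) 1 := by
      simpa [abs_of_pos h0] using h1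
    let w : UnitBall d := ⟨_, hr⟩
    have hin : inner ℂ (coordMul i (druryArvesonOne d))
        (RKHS.kerFun (DruryArveson d) w 1 - druryArvesonOne d) = (r : ℂ) := by
      rw [druryArvesonOne, inner_sub_right, RKHS.inner_kerFun, RKHS.inner_kerFun,
        ← druryArvesonOne, coordMul_apply, coordMul_apply, druryArvesonOne_apply]
      simp [w, druryArvesonOne_apply]
    have hk : ‖RKHS.kerFun (DruryArveson d) w 1 - druryArvesonOne d‖ ^ 2 = (1 - r ^ 2)⁻¹ - 1 := by
      have hw : ‖RKHS.kerFun (DruryArveson d) w 1‖ ^ 2 = (1 - r ^ 2)⁻¹ := by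
        have h := inner_kerFun_druryArveson w w
        rw [inner_self_eq_norm_sq_to_K, inner_self_eq_norm_sq_to_K] at h
        have hwr : ‖(w : EuclideanSpace ℂ (Fin d))‖ = r := by simp [w, abs_of_pos h0]
        rw [hwr] at h
        refine Complex.ofReal_injective ?_
        push_cast
        simpa using h
      rw [@norm_sub_sq ℂ, hw, norm_druryArvesonOne, druryArvesonOne, inner_kerFun_druryArveson]
      simp
      ring
    have hcs := norm_inner_le_norm (𝕜 := ℂ) (coordMul i (druryArvesonOne d))
      (RKHS.kerFun (DruryArveson d) w 1 - druryArvesonOne d)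
    rw [hin, Complex.norm_real, Real.norm_of_nonneg h0.le, ← hN] at hcs
    have hsq := pow_le_pow_left₀ h0.le hcs 2
    have hpos : 0 < 1 - r ^ 2 := by nlinarith
    rw [mul_pow, hk] at hsq
    have : N ^ 2 * ((1 - r ^ 2)⁻¹ - 1) * (1 - r ^ 2) = N ^ 2 * r ^ 2 := by
      field_simp
      ring
    have hm := mul_le_mul_of_nonneg_right hsq hpos.le
    rw [this, mul_comm, mul_comm (N ^ 2)] at hm
    nlinarith [le_of_mul_le_mul_right (by linarith : (1 - r ^ 2) * r ^ 2 ≤ N ^ 2 * r ^ 2)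
      (by positivity : 0 < r ^ 2)]
  have h0 : 0 ≤ N := norm_nonneg _
  by_contra! hlt
  -- For this r, 1 - N² = 2r(1 + N) ≥ 2r > r².
  have := key ((1 - N) / 2) (by linarith) (by linarith)
  nlinarith

theorem mainTheorem5 (d : ℕ) (hd : 2 ≤ d) :
    ¬ HasA11 (matrixAlgebra 6 (multiplierAlgebra (DruryArveson d))) :=
  not_hasA11_matrixAlgebra (coordMul_mem ⟨0, by omega⟩) (coordMul_mem ⟨1, by omega⟩)
    (norm_druryArvesonOne d) (norm_coordMul_one _) (norm_coordMul_one _) (norm_coordMul_le _)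
    (norm_sq_coordMul_add_le (by simp))
end
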